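/- Let $x_1,\dots,x_n,y_1,\dots,y_n\in\mathbb R^d$, let $r,c$ be probability vectors in $\mathbb R^n$, and let $1\le k\le d$. Write $\Pi=\{\pi\in\mathbb R_+^{n\times n}:\pi\mathbf 1=r,\ \pi^\top\mathbf 1=c\}$, $\mathrm{St}(d,k)=\{U\in\mathbb R^{d\times k}:U^\top U=I\}$, and $$f(\pi,U)=\sum_{i,j=1}^n\pi_{ij}\,\|U^\top x_i-U^\top y_j\|^2,\qquad f(U)=\min_{\pi\in\Pi}f(\pi,U).$$ The tangent space is $T_U\mathrm{St}=\{\xi\in\mathbb R^{d\times k}:\xi^\top U+U^\top\xi=0\}$. With the metric induced by the Frobenius inner product, $\mathrm{grad}_U f(\pi,U)=\mathrm{Proj}_{T_U\mathrm{St}}\nabla_U f(\pi,U)$ is the Riemannian gradient and $\mathrm{subdiff}\,f(U)=\mathrm{Proj}_{T_U\mathrm{St}}(\partial f(U))$ is the Riemannian subdifferential, where $\partial f$ is the Clarke subdifferential of $f$ as a function on $\mathbb R^{d\times k}$. A pair $(\hat\pi,\hat U)\in\Pi\times\mathrm{St}(d,k)$ is called an $(\epsilon_1,\epsilon_2)$-stationary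 point of $\max_{U\in\mathrm{St}(d,k)}\min_{\pi\in\Pi}f(\pi,U)$ if $\|\mathrm{grad}_U f(\hat\pi,\hat U)\|_F\le\epsilon_1$ and $f(\hat\pi,\hat U)-\min_{\pi\in\Pi}f(\pi,\hat U)\le\epsilon_2$. It is called an $\epsilon$-stationary point in the sense of Lin et al. if $\mathrm{dist}(0,\mathrm{subdiff}\,f(\hat U))\le\epsilon$ and $f(\hat\pi,\hat U)-\min_{\pi\in\Pi}f(\pi,\hat U)\le\epsilon$. For every $\hat U\in\mathrm{St}(d,k)$ there is a constant $\theta>0$, which may depend on the problem data $(x_i),(y_j),r,c$ and on $\hat U$ but not on $\epsilon$ or $\hat\pi$, such that for every $\epsilon$ and every $\hat\pi$: if $(\hat\pi,\hat U)$ is an $(\epsilon,\epsilon)$-stationary point, then $$\mathrm{dist}(0,\mathrm{subdiff}\,f(\hat U))\le(2\theta+1)\,\epsilon .$$ Consequently $(\hat\pi,\hat U)$ is a $(2\theta+1)\epsilon$-stationary point in the sense of Lin et al. -/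

import Mathlib

open Filter Topology
open scoped Matrix

noncomputable section

namespace PRW

/-- The Euclidean space `ℝ^{d×k}` of real `d × k` matrices, with the inner product
`⟪ξ, η⟫ = ∑ᵢⱼ ξᵢⱼ ηᵢⱼ = Tr (ξᵀ η)`; its norm is the Frobenius norm. -/
abbrev MatSpace (d k : ℕ) : Type := EuclideanSpace ℝ (Fin d × Fin k)

variable {n d k : ℕ}

/-- The element of `ℝ^{d×k}` read as a matrix. -/
def toMat (U : MatSpace d k) : Matrix (Fin d) (Fin k) ℝ :=
  Matrix.of fun a b => U (a, b)

/-- The Stiefel manifold `St(d,k) = {U : Uᵀ U = I}`. -/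
def stiefel (d k : ℕ) : Set (MatSpace d k) :=
  {U | (toMat U)ᵀ * toMat U = 1}

/-- The tangent space `T_U St(d,k) = {ξ : ξᵀ U + Uᵀ ξ = 0}`. -/
def tangentSpace (U : MatSpace d k) : Submodule ℝ (MatSpace d k) where
  carrier := {ξ | (toMat ξ)ᵀ * toMat U + (toMat U)ᵀ * toMat ξ = 0}
  zero_mem' := by
    have h : toMat (0 : MatSpace d k) = 0 := by ext a b; simp [toMat]
    simp [h]
  add_mem' := by
    intro ξ η hξ hη
    have h : toMat (ξ + η) = toMat ξ + toMat η := by ext a b; simp [toMat]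
    simp only [Set.mem_ofPred_eq] at hξ hη ⊢
    rw [h, Matrix.transpose_add, Matrix.add_mul, Matrix.mul_add, add_add_add_comm, hξ, hη,
      add_zero]
  smul_mem' := by
    intro t ξ hξ
    have h : toMat (t • ξ) = t • toMat ξ := by ext a b; simp [toMat]
    simp only [Set.mem_ofPred_eq] at hξ ⊢
    rw [h, Matrix.transpose_smul, Matrix.smul_mul, Matrix.mul_smul, ← smul_add, hξ, smul_zero]

/-- The projected point `Uᵀ p ∈ ℝ^k`, with the Euclidean norm on `ℝ^k`. -/
def projPoint (U : MatSpace d k) (p : EuclideanSpace ℝ (Fin d)) : EuclideanSpace ℝ (Fin k) :=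
  WithLp.toLp 2 ((toMat U)ᵀ *ᵥ WithLp.ofLp p)

/-- The transportation polytope `Π(μ,ν) = {π ∈ ℝ₊^{n×n} : π 1 = r, πᵀ 1 = c}`. -/
def couplings (r c : Fin n → ℝ) : Set (Matrix (Fin n) (Fin n) ℝ) :=
  {π | (∀ i j, 0 ≤ π i j) ∧ (∀ i, ∑ j, π i j = r i) ∧ ∀ j, ∑ i, π i j = c j}

/-- `f(π,U) = ∑ᵢⱼ πᵢⱼ ‖Uᵀ xᵢ - Uᵀ yⱼ‖²`. -/
def cost (x y : Fin n → EuclideanSpace ℝ (Fin d)) (π : Matrix (Fin n) (Fin n) ℝ)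
    (U : MatSpace d k) : ℝ :=
  ∑ i, ∑ j, π i j * ‖projPoint U (x i) - projPoint U (y j)‖ ^ 2

/-- `f(U) = min_{π ∈ Π(μ,ν)} f(π,U)`. For `r`, `c` in the simplex the polytope is compact and
nonempty, so the infimum is a minimum. -/
def minCost (x y : Fin n → EuclideanSpace ℝ (Fin d)) (r c : Fin n → ℝ) (U : MatSpace d k) : ℝ :=
  sInf ((fun π => cost x y π U) '' couplings r c)

/-- The Riemannian gradient for the metric induced from `ℝ^{d×k}`: the orthogonal projection of
the Euclidean gradient onto the tangent space. -/
def riemGrad (F : MatSpace d k → ℝ) (U : MatSpace d k) : MatSpace d k :=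
  (tangentSpace U).starProjection (gradient F U)

/-- Clarke's generalized directional derivative
`F°(U;V) = limsup_{W → U, t ↓ 0} (F(W + tV) - F(W)) / t`. -/
def clarkeDeriv (F : MatSpace d k → ℝ) (U V : MatSpace d k) : EReal :=
  limsup (fun p : MatSpace d k × ℝ => (((F (p.1 + p.2 • V) - F p.1) / p.2 : ℝ) : EReal))
    (𝓝 U ×ˢ 𝓝[>] (0 : ℝ))

/-- The (Euclidean) Clarke subdifferential `∂F(U) = {ξ : ⟪ξ, V⟫ ≤ F°(U;V) for all V}`. -/
def clarkeSubdiff (F : MatSpace d k → ℝ) (U : MatSpace d k) : Set (MatSpace d k) :=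
  {ξ | ∀ V : MatSpace d k, ((inner ℝ ξ V : ℝ) : EReal) ≤ clarkeDeriv F U V}

/-- The Riemannian subdifferential on the Stiefel manifold,
`subdiff F(U) = Proj_{T_U St} (∂F(U))`. -/
def riemSubdiff (F : MatSpace d k → ℝ) (U : MatSpace d k) : Set (MatSpace d k) :=
  (fun ξ => (tangentSpace U).starProjection ξ) '' clarkeSubdiff F U

/-- `(ε₁,ε₂)`-stationary points of the projection robust Wasserstein problem. -/
structure IsStationary (x y : Fin n → EuclideanSpace ℝ (Fin d)) (r c : Fin n → ℝ)
    (ε₁ ε₂ : ℝ) (π : Matrix (Fin n) (Fin n) ℝ) (U : MatSpace d k) : Prop where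
  mem_couplings : π ∈ couplings r c
  mem_stiefel : U ∈ stiefel d k
  grad_le : ‖riemGrad (cost x y π) U‖ ≤ ε₁
  gap_le : cost x y π U - minCost x y r c U ≤ ε₂

/-- `ε`-stationary points in the sense of Lin et al. The distance is taken in `[0,∞]`, so that it
is infinite if the subdifferential is empty. -/
structure IsLinStationary (x y : Fin n → EuclideanSpace ℝ (Fin d)) (r c : Fin n → ℝ)
    (ε : ℝ) (π : Matrix (Fin n) (Fin n) ℝ) (U : MatSpace d k) : Prop where
  mem_couplings : π ∈ couplings r c
  mem_stiefel : U ∈ stiefel d k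
  dist_le : Metric.infEDist 0 (riemSubdiff (minCost x y r c) U) ≤ ENNReal.ofReal ε
  gap_le : cost x y π U - minCost x y r c U ≤ ε

end PRW

end

open Filter Topology
open scoped Matrix

namespace PRW

/-! For fixed `U`, both the cost and its Riemannian gradient are linear in `π`, and the couplings
form a polytope. A linear program over a polytope is sharp: by `exists_linear_sharpness`, any
coupling `π` has an optimal partner `ρ` whose gradient differs from that of `π` by at most `θ` times
the optimality gap, with `θ` independent of `π`. Since `minCost` lies below `cost x y ρ` and touches
it at `U`, the gradient of the latter is a Clarke subgradient (`gradient_mem_clarkeSubdiff_of_le`).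
Its projection has norm at most `ε + θ * ε`, which bounds the distance. -/

/-- Sharpness of a linear program over a polytope, measured through a linear map `G`. -/
lemma exists_linear_sharpness {E F : Type*} [AddCommGroup E] [Module ℝ E]
    [NormedAddCommGroup F] [NormedSpace ℝ F] {S : Set E} (hS : S.Finite) (hne : S.Nonempty)
    (g : E →ₗ[ℝ] ℝ) (G : E →ₗ[ℝ] F) :
    ∃ C : ℝ, 0 < C ∧ ∀ p ∈ convexHull ℝ S, ∃ q ∈ convexHull ℝ S,
      (∀ p' ∈ convexHull ℝ S, g q ≤ g p') ∧ ‖G p - G q‖ ≤ C * (g p - g q) := by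
  obtain ⟨v, hvS, hv⟩ := S.exists_min_image g hS hne
  have hmin : ∀ p ∈ convexHull ℝ S, g v ≤ g p :=
    convexHull_min (t := {p | g v ≤ g p}) hv (convex_halfSpace_ge g.isLinear _)
  have hterm : ∀ w ∈ hS.toFinset, 0 ≤ ‖G w - G v‖ / (g w - g v) := fun w hw =>
    div_nonneg (norm_nonneg _) (sub_nonneg.2 (hv w (hS.mem_toFinset.1 hw)))
  -- The sum dominates each ratio. Minimizing vertices contribute `0` through division by zero, and
  -- the `1` keeps `C` positive if all terms vanish.
  set C : ℝ := 1 + ∑ w ∈ hS.toFinset, ‖G w - G v‖ / (g w - g v) with hC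
  have hC0 : 0 < C := by
    have := Finset.sum_nonneg hterm
    linarith
  refine ⟨C, hC0, ?_⟩
  -- Pairs `(p, q)` satisfying these conditions are stable under convex combination, so the set on
  -- the right is convex and it suffices to check the vertices.
  suffices h : convexHull ℝ S ⊆
      {p | ∃ q ∈ convexHull ℝ S, g q = g v ∧ ‖G p - G q‖ ≤ C * (g p - g v)} by
    intro p hp
    obtain ⟨q, hq, hqv, hpq⟩ := h hp
    exact ⟨q, hq, fun p' hp' => hqv ▸ hmin p' hp', hqv ▸ hpq⟩
  refine convexHull_min ?_ ?_
  · intro w hw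
    rcases (hv w hw).eq_or_lt with h | h
    · exact ⟨w, subset_convexHull ℝ S hw, h.symm, by simp [h]⟩
    · refine ⟨v, subset_convexHull ℝ S hvS, rfl, ?_⟩
      have h1 := Finset.single_le_sum hterm (hS.mem_toFinset.2 hw)
      have h2 : ‖G w - G v‖ / (g w - g v) ≤ C := by linarith
      exact (div_le_iff₀ (sub_pos.2 h)).1 h2
  · rintro p₁ ⟨q₁, hq₁, e₁, h₁⟩ p₂ ⟨q₂, hq₂, e₂, h₂⟩ a b ha hb hab
    refine ⟨a • q₁ + b • q₂, convex_convexHull ℝ S hq₁ hq₂ ha hb hab, ?_, ?_⟩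
    · simp only [map_add, map_smul, e₁, e₂, smul_eq_mul]
      rw [← add_mul, hab, one_mul]
    · have e : G (a • p₁ + b • p₂) - G (a • q₁ + b • q₂)
          = a • (G p₁ - G q₁) + b • (G p₂ - G q₂) := by
        simp only [map_add, map_smul, smul_sub]
        abel
      have h3 : ‖a • (G p₁ - G q₁) + b • (G p₂ - G q₂)‖
          ≤ a * ‖G p₁ - G q₁‖ + b * ‖G p₂ - G q₂‖ := by
        refine (norm_add_le _ _).trans_eq ?_
        rw [norm_smul_of_nonneg ha, norm_smul_of_nonneg hb]
      rw [e]
      refine h3.trans ?_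
      simp only [map_add, map_smul, smul_eq_mul]
      have h4 := mul_le_mul_of_nonneg_left h₁ ha
      have h5 := mul_le_mul_of_nonneg_left h₂ hb
      have h6 : g v = a * g v + b * g v := by rw [← add_mul, hab, one_mul]
      rw [h6]
      linarith

/-- The couplings as a subset of the function space `Fin n → Fin n → ℝ`. -/
def couplingSet {n : ℕ} (r c : Fin n → ℝ) : Set (Fin n → Fin n → ℝ) :=
  {p | (∀ i j, 0 ≤ p i j) ∧ (∀ i, ∑ j, p i j = r i) ∧ ∀ j, ∑ i, p i j = c j}

/-- Two extreme couplings with the same zero pattern coincide. -/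
lemma eq_of_extreme_of_support {n : ℕ} {r c : Fin n → ℝ} {p q : Fin n → Fin n → ℝ}
    (hp : p ∈ (couplingSet r c).extremePoints ℝ)
    (hq : q ∈ couplingSet r c)
    (h : ∀ i j, p i j = 0 → q i j = 0) : p = q := by
  obtain ⟨⟨hp0, hpr, hpc⟩, hext⟩ := mem_extremePoints.1 hp
  obtain ⟨hq0, hqr, hqc⟩ := hq
  -- Moving from `p` away from `q` keeps entries nonnegative for small `t`: positive entries by
  -- continuity, zero entries because they do not move.
  have hnear : ∀ i j, ∀ᶠ t : ℝ in 𝓝[>] 0, 0 ≤ p i j + t * (p i j - q i j) := by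
    intro i j
    rcases (hp0 i j).eq_or_lt with h0 | h0
    · simp [← h0, h i j h0.symm]
    · have hc : ContinuousAt (fun t : ℝ => p i j + t * (p i j - q i j)) 0 := by fun_prop
      have := hc.eventually (lt_mem_nhds (a := 0) (by simpa using h0))
      exact (this.filter_mono nhdsWithin_le_nhds).mono fun t ht => ht.le
  have hall : ∀ᶠ t : ℝ in 𝓝[>] 0, ∀ i j, 0 ≤ p i j + t * (p i j - q i j) :=
    eventually_all.2 fun i => eventually_all.2 fun j => hnear i j
  obtain ⟨t, ht, ht0⟩ := (hall.and self_mem_nhdsWithin).exists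
  have ht0 : 0 < t := ht0
  have hmem : (p + t • (p - q) : Fin n → Fin n → ℝ) ∈
      couplingSet r c := by
    refine ⟨fun i j => by simpa using ht i j, fun i => ?_, fun j => ?_⟩
    · simp [Finset.sum_add_distrib, ← Finset.mul_sum, hpr, hqr]
    · simp [Finset.sum_add_distrib, ← Finset.mul_sum, hpc, hqc]
  -- Now `p` lies strictly between two couplings, so extremality forces `q = p`.
  have hseg : p ∈ openSegment ℝ (p + t • (p - q)) q := by
    refine ⟨1 / (1 + t), t / (1 + t), by positivity, by positivity, by field_simp, ?_⟩
    ext i j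
    simp
    field_simp
    ring
  exact ((hext _ hmem q ⟨hq0, hqr, hqc⟩ hseg).2).symm

/-- A vertex is determined by its zero pattern, and there are finitely many patterns. -/
lemma finite_extremePoints_couplingSet {n : ℕ} (r c : Fin n → ℝ) :
    ((couplingSet r c).extremePoints ℝ).Finite := by
  refine Set.Finite.of_injOn (f := fun p : Fin n → Fin n → ℝ => {s : Fin n × Fin n | p s.1 s.2 = 0})
    (Set.mapsTo_univ _ _) ?_ Set.finite_univ
  intro p hp q hq h
  refine eq_of_extreme_of_support hp hq.1 fun i j hij => ?_
  exact (Set.ext_iff.1 h (i, j)).1 hij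

lemma isCompact_couplingSet {n : ℕ} (r c : Fin n → ℝ) :
    IsCompact (couplingSet r c) := by
  refine IsCompact.of_isClosed_subset
    (isCompact_univ_pi fun i => isCompact_univ_pi fun _ => isCompact_Icc (a := 0) (b := r i)) ?_ ?_
  · simp only [couplingSet, Set.ofPred_and, Set.ofPred_forall]
    refine (isClosed_iInter fun i => isClosed_iInter fun j => ?_).inter
      ((isClosed_iInter fun i => ?_).inter (isClosed_iInter fun j => ?_))
    · exact isClosed_le (by fun_prop) (by fun_prop)
    · exact isClosed_eq (by fun_prop) (by fun_prop)
    · exact isClosed_eq (by fun_prop) (by fun_prop)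
  · intro p hp i _ j _
    refine ⟨hp.1 i j, ?_⟩
    rw [← hp.2.1 i]
    exact Finset.single_le_sum (fun j _ => hp.1 i j) (Finset.mem_univ j)

lemma convex_couplingSet {n : ℕ} (r c : Fin n → ℝ) :
    Convex ℝ (couplingSet r c) := by
  rintro p ⟨hp0, hpr, hpc⟩ q ⟨hq0, hqr, hqc⟩ a b ha hb hab
  refine ⟨fun i j => ?_, fun i => ?_, fun j => ?_⟩
  · have := hp0 i j
    have := hq0 i j
    simp only [Pi.add_apply, Pi.smul_apply, smul_eq_mul]
    positivity
  · simp [Finset.sum_add_distrib, ← Finset.mul_sum, hpr, hqr, ← add_mul, hab]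
  · simp [Finset.sum_add_distrib, ← Finset.mul_sum, hpc, hqc, ← add_mul, hab]

/-- Krein–Milman; the closure is superfluous because the hull of a finite set is closed. -/
lemma convexHull_extremePoints_couplingSet {n : ℕ} (r c : Fin n → ℝ) :
    convexHull ℝ ((couplingSet r c).extremePoints ℝ) = couplingSet r c := by
  have h := closure_convexHull_extremePoints (isCompact_couplingSet r c) (convex_couplingSet r c)
  rwa [((finite_extremePoints_couplingSet r c).isClosed_convexHull ℝ).closure_eq] at h

lemma couplingSet_nonempty {n : ℕ} {r c : Fin n → ℝ}
    (hr : r ∈ stdSimplex ℝ (Fin n)) (hc : c ∈ stdSimplex ℝ (Fin n)) :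
    (couplingSet r c).Nonempty :=
  ⟨fun i j => r i * c j, fun i j => mul_nonneg (hr.1 i) (hc.1 j),
    fun i => by rw [← Finset.mul_sum, hc.2, mul_one],
    fun j => by rw [← Finset.sum_mul, hr.2, one_mul]⟩

variable {n d k : ℕ}

lemma differentiable_sq_norm_projPoint_sub (p q : EuclideanSpace ℝ (Fin d)) :
    Differentiable ℝ fun U : MatSpace d k => ‖projPoint U p - projPoint U q‖ ^ 2 := by
  have h : ∀ p : EuclideanSpace ℝ (Fin d),
      Differentiable ℝ fun U : MatSpace d k => projPoint U p := by
    intro p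
    rw [differentiable_euclidean]
    intro b
    simp only [projPoint, Matrix.mulVec, dotProduct, Matrix.transpose_apply, toMat, Matrix.of_apply]
    fun_prop
  exact ((h p).sub (h q)).norm_sq ℝ

lemma hasFDerivAt_cost (x y : Fin n → EuclideanSpace ℝ (Fin d)) (π : Matrix (Fin n) (Fin n) ℝ)
    (U : MatSpace d k) :
    HasFDerivAt (cost x y π) (∑ i, ∑ j, π i j •
      fderiv ℝ (fun U : MatSpace d k => ‖projPoint U (x i) - projPoint U (y j)‖ ^ 2) U) U := by
  refine HasFDerivAt.fun_sum fun i _ => HasFDerivAt.fun_sum fun j _ => ?_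
  exact (differentiable_sq_norm_projPoint_sub (x i) (y j) U).hasFDerivAt.const_mul _

/-- The Riemannian gradient of `cost x y π` at `U`, as a linear function of `π`. -/
noncomputable def riemGradLinear (x y : Fin n → EuclideanSpace ℝ (Fin d)) (U : MatSpace d k) :
    (Fin n → Fin n → ℝ) →ₗ[ℝ] MatSpace d k where
  toFun π := riemGrad (cost x y (Matrix.of π)) U
  map_add' π ρ := by
    simp only [riemGrad, gradient, (hasFDerivAt_cost x y _ U).fderiv, Matrix.of_apply,
      Pi.add_apply, add_smul, Finset.sum_add_distrib, map_add]
  map_smul' t π := by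
    simp only [riemGrad, gradient, (hasFDerivAt_cost x y _ U).fderiv, Matrix.of_apply,
      Pi.smul_apply, smul_assoc, ← Finset.smul_sum, RingHom.id_apply]
    -- The Riesz isomorphism inside `gradient` is conjugate-linear, hence linear over `ℝ`.
    simp only [map_smulₛₗ, conj_trivial, RingHom.id_apply]

/-- `cost x y π U` as a linear function of `π`. -/
noncomputable def costLinear (x y : Fin n → EuclideanSpace ℝ (Fin d)) (U : MatSpace d k) :
    (Fin n → Fin n → ℝ) →ₗ[ℝ] ℝ where
  toFun π := cost x y (Matrix.of π) U
  map_add' π ρ := by simp [cost, add_mul, Finset.sum_add_distrib]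
  map_smul' t π := by simp [cost, Finset.mul_sum, mul_assoc]

lemma minCost_le (x y : Fin n → EuclideanSpace ℝ (Fin d)) {r c : Fin n → ℝ}
    {π : Matrix (Fin n) (Fin n) ℝ} (hπ : π ∈ couplings r c) (U : MatSpace d k) :
    minCost x y r c U ≤ cost x y π U := by
  refine csInf_le ⟨0, ?_⟩ ⟨π, hπ, rfl⟩
  rintro _ ⟨ρ, hρ, rfl⟩
  exact Finset.sum_nonneg fun i _ => Finset.sum_nonneg fun j _ =>
    mul_nonneg (hρ.1 i j) (sq_nonneg _)

lemma minCost_eq (x y : Fin n → EuclideanSpace ℝ (Fin d)) {r c : Fin n → ℝ}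
    {π : Matrix (Fin n) (Fin n) ℝ} {U : MatSpace d k} (hπ : π ∈ couplings r c)
    (hmin : ∀ ρ ∈ couplings r c, cost x y π U ≤ cost x y ρ U) :
    minCost x y r c U = cost x y π U := by
  refine (minCost_le x y hπ U).antisymm (le_csInf ⟨_, π, hπ, rfl⟩ ?_)
  rintro _ ⟨ρ, hρ, rfl⟩
  exact hmin ρ hρ

/-- The gradient of a differentiable upper bound of `F` that touches `F` at `U` is a Clarke
subgradient of `F` at `U`. -/
lemma gradient_mem_clarkeSubdiff_of_le {F H : MatSpace d k → ℝ} {U : MatSpace d k}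
    (hH : DifferentiableAt ℝ H U) (hle : ∀ W, F W ≤ H W) (heq : F U = H U) :
    gradient H U ∈ clarkeSubdiff F U := by
  intro V
  -- Clarke's limsup allows the base point to vary. Taking it to be `U - t • V` puts the touching
  -- point `U` at the end of the step, so `F ≤ H` enters with a minus sign and bounds the quotient
  -- of `F` from below.
  have htend : Tendsto (fun t : ℝ => (U - t • V, t)) (𝓝[>] 0) (𝓝 U ×ˢ 𝓝[>] (0 : ℝ)) := by
    refine Tendsto.prodMk ?_ tendsto_id
    have hcont : Continuous fun t : ℝ => U - t • V := by fun_prop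
    simpa using (hcont.tendsto 0).mono_left nhdsWithin_le_nhds
  have hderiv : HasDerivAt (fun t : ℝ => -H (U - t • V)) (inner ℝ (gradient H U) V) 0 := by
    have h1 : HasDerivAt (fun t : ℝ => U - t • V) (-V) 0 := by
      simpa using ((hasDerivAt_id (0 : ℝ)).smul_const V).const_sub U
    have h2 : HasFDerivAt H (fderiv ℝ H U) (U - (0 : ℝ) • V) := by simpa using hH.hasFDerivAt
    have h3 := (h2.comp_hasDerivAt (0 : ℝ) h1).neg
    have h4 : (inner ℝ (gradient H U) V : ℝ) = -(fderiv ℝ H U) (-V) := by simp [gradient]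
    rw [h4]
    exact h3
  have hslope : Tendsto (fun t : ℝ => (H U - H (U - t • V)) / t) (𝓝[>] 0)
      (𝓝 (inner ℝ (gradient H U) V)) := by
    have h := (hasDerivAt_iff_tendsto_slope.1 hderiv).mono_left
      (nhdsWithin_mono (0 : ℝ) fun t (ht : 0 < t) => ht.ne')
    refine h.congr fun t => ?_
    rw [slope_def_field]
    simp only [zero_smul, sub_zero]
    ring
  have hE := (continuous_coe_real_ereal.tendsto _).comp hslope
  rw [← hE.limsup_eq]
  refine le_trans ?_ (limsup_le_limsup_of_le htend)
  rw [← limsup_comp]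
  refine limsup_le_limsup ?_
  filter_upwards [self_mem_nhdsWithin] with t ht
  have ht : 0 < t := ht
  simp only [Function.comp_apply, sub_add_cancel, EReal.coe_le_coe_iff, heq]
  gcongr
  exact hle _

end PRW

theorem mainTheorem5 (n d k : ℕ) (hk : 1 ≤ k) (hkd : k ≤ d)
    (x y : Fin n → EuclideanSpace ℝ (Fin d)) (r c : Fin n → ℝ)
    (hr : r ∈ stdSimplex ℝ (Fin n)) (hc : c ∈ stdSimplex ℝ (Fin n))
    (U : PRW.MatSpace d k) (hU : U ∈ PRW.stiefel d k) :
    ∃ θ : ℝ, 0 < θ ∧ ∀ (ε : ℝ) (π : Matrix (Fin n) (Fin n) ℝ),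
      PRW.IsStationary x y r c ε ε π U →
        Metric.infEDist 0 (PRW.riemSubdiff (PRW.minCost x y r c) U)
            ≤ ENNReal.ofReal ((2 * θ + 1) * ε) ∧
          PRW.IsLinStationary x y r c ((2 * θ + 1) * ε) π U := by
  have hhull := PRW.convexHull_extremePoints_couplingSet r c
  have hne := PRW.couplingSet_nonempty hr hc
  obtain ⟨θ, hθ, hsharp⟩ := PRW.exists_linear_sharpness
    (PRW.finite_extremePoints_couplingSet r c)
    (convexHull_nonempty_iff.1 (hhull ▸ hne)) (PRW.costLinear x y U) (PRW.riemGradLinear x y U)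
  rw [hhull] at hsharp
  refine ⟨θ, hθ, fun ε π hs => ?_⟩
  obtain ⟨ρ, hρ, hmin, hdist⟩ := hsharp π hs.mem_couplings
  have hε : 0 ≤ ε := (norm_nonneg _).trans hs.grad_le
  have hθε : 0 ≤ θ * ε := mul_nonneg hθ.le hε
  have hval : PRW.minCost x y r c U = PRW.cost x y ρ U := PRW.minCost_eq x y hρ hmin
  have hgap : PRW.cost x y π U - PRW.cost x y ρ U ≤ ε := hval ▸ hs.gap_le
  have hmem : PRW.riemGrad (PRW.cost x y ρ) U ∈ PRW.riemSubdiff (PRW.minCost x y r c) U :=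
    ⟨_, PRW.gradient_mem_clarkeSubdiff_of_le
      (PRW.hasFDerivAt_cost x y ρ U).differentiableAt (PRW.minCost_le x y hρ) hval, rfl⟩
  -- The argument gives `(θ + 1) * ε`; the remaining `θ * ε` is slack.
  have hnorm : ‖PRW.riemGrad (PRW.cost x y ρ) U‖ ≤ (2 * θ + 1) * ε := by
    have h1 : ‖PRW.riemGrad (PRW.cost x y π) U - PRW.riemGrad (PRW.cost x y ρ) U‖ ≤ θ * ε :=
      hdist.trans (mul_le_mul_of_nonneg_left hgap hθ.le)
    have h2 := norm_le_norm_add_norm_sub (PRW.riemGrad (PRW.cost x y π) U)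
      (PRW.riemGrad (PRW.cost x y ρ) U)
    have h3 := hs.grad_le
    linarith
  have hd : Metric.infEDist 0 (PRW.riemSubdiff (PRW.minCost x y r c) U)
      ≤ ENNReal.ofReal ((2 * θ + 1) * ε) := by
    refine (Metric.infEDist_le_edist_of_mem hmem).trans ?_
    rw [edist_dist, dist_zero_left]
    exact ENNReal.ofReal_le_ofReal hnorm
  have hgap' := hs.gap_le
  exact ⟨hd, hs.mem_couplings, hs.mem_stiefel, hd, by linarith⟩
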